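/- Let $\mathcal G=(\mathcal V,\mathcal E)$ be a finite directed network with unit-capacity edges, source $s$, terminal $t\neq s$, internal nodes $\overline{\mathcal V}=\mathcal V\setminus\{s,t\}$, and min-cut $C$ between $s$ and $t$. Let $\mathcal P$ be the set of simple directed paths from $s$ to $t$, let $z\ge 0$ be an integer, and let $\lambda(z)$ be the optimal value of the variable $\lambda$ in the linear program $$\max\ C-\lambda\quad\text{s.t.}\quad F(p)\ge 0\ (p\in\mathcal P),\quad \sum_{p\ni e}F(p)\le 1\ (e\in\mathcal E),\quad \sum_{p\cap\mathcal Z\ne\emptyset}F(p)\le\lambda\ (\mathcal Z\subseteq\overline{\mathcal V},\ |\mathcal Z|\le z),\quad \sum_{p\in\mathcal P}F(p)=C .$$ A routing-only code over a finite field $\mathbb F_q$ with packet length $n$ and generation length $\tau$ works as follows. The source encodes a message $M$ from a set $\mathcal M$ and an independent uniform key $K$, known only to the source, into at most $\tau C$ packets in $\mathbb F_q^n$, and at each time $i\in\{1,\dots,\tau\}$ emits on each of its outgoing edges one of these packets or nothing. At each time $i$, each outgoing edge of an internal node carries nothing or a copy of a packet that arrived at that node at some time $j\le i$, as prescribed by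 the code. The terminal decodes $\widehat M$ from the packets on its incoming edges. The rate of the code is $\frac{1}{n\tau}\log_q|\mathcal M|$. A causal omniscient jammer chooses a set $\mathcal Z\subseteq\overline{\mathcal V}$ with $|\mathcal Z|\le z$ and replaces the packets on the outgoing edges of $\mathcal Z$; what it transmits at time $i$ is an arbitrary, possibly randomized, function of the packets on all edges of the network at times $j\le i$, of $\mathcal G$ and of the code. A rate $R$ is achievable against such a jammer if for all $\varepsilon,\delta>0$ there is a generation length $\tau$ such that for all sufficiently large $n$ and $q$ there is a code with these parameters, of rate at least $R-\delta$, for which $\Pr(\widehat M\ne M)<\varepsilon$ for every message and every such jammer. **Theorem 5.** If $\lambda(z)<C/2$, then the rate $R=C-\lambda(z)$ is achievable by routing-only codes against a causal omniscient jammer controlling at most $z$ internal nodes. -/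

import Mathlib

open scoped ENNReal

/-- A directed network with vertices `V` and directed unit-capacity edges `E` (parallel edges are
allowed), a source and a different terminal. Edge `e` points from `tail e` to `head e`. -/
structure Network (V E : Type*) where
  tail : E → V
  head : E → V
  source : V
  terminal : V
  source_ne_terminal : source ≠ terminal

namespace Network

variable {V E : Type*} (G : Network V E)

/-- The min-cut between source and terminal: the least number of edges leaving a vertex set that
contains the source and not the terminal. -/
noncomputable def minCut : ℕ :=
  sInf {c | ∃ S : Set V, G.source ∈ S ∧ G.terminal ∉ S ∧
    c = {e | G.tail e ∈ S ∧ G.head e ∉ S}.ncard}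

/-- The vertices visited by a list of consecutive edges that starts at the source. -/
def pathNodes (p : List E) : List V := G.source :: p.map G.head

/-- `p` is the edge list of a (simple, directed) path from the source to the terminal. -/
structure IsPath (p : List E) : Prop where
  starts : p.head?.map G.tail = some G.source
  ends : p.getLast?.map G.head = some G.terminal
  chain : p.IsChain fun e e' => G.head e = G.tail e'
  nodup : (G.pathNodes p).Nodup

theorem finite_isPath [Finite E] : {p : List E | G.IsPath p}.Finite := by
  classical
  have := Fintype.ofFinite E
  have : Fintype {p : List E // p.Nodup} := fintypeNodupList
  have h : {p : List E | p.Nodup}.Finite :=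
    Set.finite_coe_iff.1 (Finite.of_fintype {p : List E // p.Nodup})
  exact h.subset fun p hp => (List.nodup_cons.1 hp.nodup).2.of_map _

/-- The set of all paths from the source to the terminal. -/
noncomputable def paths [Finite E] : Finset (List E) := G.finite_isPath.toFinset

/-- A set of at most `z` internal nodes. -/
def IsInternalSet (z : ℕ) (Z : Finset V) : Prop :=
  G.source ∉ Z ∧ G.terminal ∉ Z ∧ Z.card ≤ z

open Classical in
/-- `(flow, lam)` is a feasible point of the routing linear program: a path flow of total value
`C`, the min-cut, that respects the unit capacities, and such that at most `lam` of it passes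
through any set of at most `z` internal nodes. -/
structure LPFeasible [Finite E] (z : ℕ) (flow : List E → ℝ) (lam : ℝ) : Prop where
  nonneg : ∀ p ∈ G.paths, 0 ≤ flow p
  capacity : ∀ e : E, ∑ p ∈ G.paths with e ∈ p, flow p ≤ 1
  balance : ∀ Z : Finset V, G.IsInternalSet z Z →
    ∑ p ∈ G.paths with (∃ v ∈ G.pathNodes p, v ∈ Z), flow p ≤ lam
  total : ∑ p ∈ G.paths, flow p = G.minCut

/-- `lam` is the value of the variable `λ(z)` at an optimal solution of the routing linear program
`max C - λ(z)`, that is, the least feasible `λ(z)`. -/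
def IsLPOptimum [Finite E] (z : ℕ) (lam : ℝ) : Prop :=
  IsLeast {l : ℝ | ∃ flow : List E → ℝ, G.LPFeasible z flow l} lam

end Network

/-- The packets carried by all edges at all times of a generation of length `τ`; a packet is a
vector of `n` symbols of `F`, and a silent edge carries the zero packet. -/
abbrev Traffic (E F : Type*) (n τ : ℕ) := E → Fin τ → Fin n → F

/-- A routing-only network code with packets in `F ^ n` and generation length `τ`. Message and key
are strings of `messageLength` and `keyLength` symbols over `F`. The source encoder maps them to
`numPackets` packets and emits on edge `e` at time `i` the packet number `inject e i` (`none` means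
silence). An edge `e` leaving an internal node carries at time `i` a copy of the packet that came
in on edge `e'` at time `j ≤ i`, where `forward e i = some (e', j)`. Copying without delay must not
run in a circle. The terminal decodes from the packets on its incoming edges. -/
structure RoutingCode {V E : Type*} (G : Network V E) (F : Type*) (n τ : ℕ) where
  messageLength : ℕ
  keyLength : ℕ
  numPackets : ℕ
  numPackets_le : numPackets ≤ τ * G.minCut
  enc : (Fin messageLength → F) → (Fin keyLength → F) → Fin numPackets → Fin n → F
  inject : E → Fin τ → Option (Fin numPackets)
  forward : E → Fin τ → Option (E × Fin τ)
  forward_causal : ∀ e i e' j, forward e i = some (e', j) → G.head e' = G.tail e ∧ j ≤ i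
  forward_wf : WellFounded fun a b : E × Fin τ => forward b.1 b.2 = some a
  dec : ({e : E // G.head e = G.terminal} → Fin τ → Fin n → F) → Fin messageLength → F

/-- A deterministic causal omniscient jamming strategy: `act X e i` is the packet put on the jammed
edge `e` at time `i` when the traffic is `X`. At time `i` it may depend on everything transmitted on
all edges of the network before time `i` and on everything that the source transmits at time `i`.
(As the honest nodes are deterministic, these data and the jammer's own packets of time `i`
determine the packets of time `i` on all other edges, so the jammer knows the packets on all edges
at all times `j ≤ i`.) -/
structure CausalJammer {V E : Type*} (G : Network V E) (F : Type*) (n τ : ℕ) where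
  act : Traffic E F n τ → E → Fin τ → Fin n → F
  causal : ∀ (X Y : Traffic E F n τ) (i : Fin τ),
    (∀ e j, j < i → X e j = Y e j) → (∀ e, G.tail e = G.source → X e i = Y e i) →
    ∀ e, act X e i = act Y e i

namespace RoutingCode

variable {V E : Type*} {G : Network V E} {F : Type*} {n τ : ℕ}

/-- The rate `log_q |M| / (n τ)`, where `M = F ^ messageLength` is the set of messages. -/
noncomputable def rate (c : RoutingCode G F n τ) : ℝ := (c.messageLength : ℝ) / (n * τ)

open Classical in
/-- The packet on edge `e` at time `i` when message `m` and key `k` are sent, the nodes in `Z` are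
jammed by `A`, and the traffic (of which only the relevant part is used) is `X`. -/
noncomputable def step [Zero F] (c : RoutingCode G F n τ) (m : Fin c.messageLength → F)
    (k : Fin c.keyLength → F) (Z : Finset V) (A : CausalJammer G F n τ)
    (X : Traffic E F n τ) (e : E) (i : Fin τ) : Fin n → F :=
  if G.tail e = G.source then (c.inject e i).elim 0 (c.enc m k)
  else if G.tail e ∈ Z then A.act X e i
  else if G.tail e = G.terminal then 0
  else (c.forward e i).elim 0 fun a => X a.1 a.2

/-- `X` is the traffic in the network when message `m` and key `k` are sent and the nodes in `Z` are
jammed by `A`. -/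
def IsTraffic [Zero F] (c : RoutingCode G F n τ) (m : Fin c.messageLength → F)
    (k : Fin c.keyLength → F) (Z : Finset V) (A : CausalJammer G F n τ)
    (X : Traffic E F n τ) : Prop :=
  ∀ e i, X e i = c.step m k Z A X e i

/-- The traffic exists and is unique. -/
theorem existsUnique_isTraffic [Zero F] (c : RoutingCode G F n τ) (m : Fin c.messageLength → F)
    (k : Fin c.keyLength → F) (Z : Finset V) (A : CausalJammer G F n τ) :
    ∃! X, c.IsTraffic m k Z A X := by
  classical
  let r : E × Fin τ → E × Fin τ → Prop := fun a b => G.tail b.1 ≠ G.source ∧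
    (a.2 < b.2 ∨ a.2 = b.2 ∧ (G.tail a.1 = G.source ∨ c.forward b.1 b.2 = some a))
  have hr : WellFounded r := by
    let φ : E × Fin τ → Fin τ × (ℕ × (E × Fin τ)) := fun a =>
      (a.2, (if G.tail a.1 = G.source then 0 else 1), a)
    have hw := (wellFounded_lt (α := Fin τ)).prod_lex
      ((wellFounded_lt (α := ℕ)).prod_lex c.forward_wf)
    refine Subrelation.wf (r := InvImage _ φ) ?_ (InvImage.wf φ hw)
    rintro a b ⟨hb, h⟩
    rcases h with h | ⟨h, h'⟩
    · exact Prod.Lex.left _ _ h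
    · refine Prod.lex_def.2 (Or.inr ⟨h, Prod.lex_def.2 ?_⟩)
      by_cases ha : G.tail a.1 = G.source
      · exact Or.inl (by simp [φ, ha, hb])
      · exact Or.inr ⟨by simp [φ, ha, hb], h'.resolve_left ha⟩
  have hstep : ∀ (X Y : Traffic E F n τ) (e : E) (i : Fin τ),
      (∀ a : E × Fin τ, r a (e, i) → X a.1 a.2 = Y a.1 a.2) →
      c.step m k Z A X e i = c.step m k Z A Y e i := by
    intro X Y e i h
    unfold step
    split_ifs with h1 h2 h3
    · rfl
    · exact A.causal X Y i (fun e' j hj => h (e', j) ⟨h1, Or.inl hj⟩)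
        (fun e' he' => h (e', i) ⟨h1, Or.inr ⟨rfl, Or.inl he'⟩⟩) e
    · rfl
    · cases hf : c.forward e i with
      | none => rfl
      | some a =>
        refine h a ⟨h1, ?_⟩
        rcases (c.forward_causal e i a.1 a.2 hf).2.lt_or_eq with h4 | h4
        · exact Or.inl h4
        · exact Or.inr ⟨h4, Or.inr hf⟩
  let W : E × Fin τ → Fin n → F := hr.fix fun b rec =>
    c.step m k Z A (fun e j => if h : r (e, j) b then rec (e, j) h else 0) b.1 b.2
  refine ⟨fun e i => W (e, i), fun e i => ?_, fun Y hY => ?_⟩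
  · change W (e, i) = _
    rw [show W (e, i) = _ from hr.fix_eq _ _]
    refine hstep _ _ e i fun a ha => ?_
    simp only [Prod.mk.eta, ha, dite_true]
    rfl
  · have key : ∀ b : E × Fin τ, Y b.1 b.2 = W b := by
      intro b
      induction b using hr.induction with
      | _ b ih =>
        rw [hY b.1 b.2, show W b = _ from hr.fix_eq _ _]
        refine hstep _ _ b.1 b.2 fun a ha => ?_
        simp only [Prod.mk.eta] at ha ⊢
        simp only [ha, dite_true]
        exact ih a ha
    funext e i
    exact key (e, i)

/-- The message decoded by the terminal from the traffic `X`. -/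
def decode (c : RoutingCode G F n τ) (X : Traffic E F n τ) : Fin c.messageLength → F :=
  c.dec fun e i => X e.1 i

/-- The probability that message `m` is decoded wrongly when the nodes in `Z` are jammed by a
possibly randomized causal omniscient jammer, whose random choice `σ` of a strategy is independent
of the uniformly distributed key. -/
noncomputable def errorProb [Zero F] [Fintype F] (c : RoutingCode G F n τ) (Z : Finset V)
    (σ : PMF (CausalJammer G F n τ)) (m : Fin c.messageLength → F) : ℝ≥0∞ :=
  ((PMF.uniformOfFintype (Fin c.keyLength → F)).bind fun k => σ.map (Prod.mk k)).toOuterMeasure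
    {kA | ∃ X, c.IsTraffic m kA.1 Z kA.2 X ∧ c.decode X ≠ m}

end RoutingCode

/-- Rate `R` is achievable by routing-only codes against a causal omniscient jammer controlling at
most `z` internal nodes: for all `ε, δ > 0` and some generation length there is, for all large
enough packet lengths and field sizes, a code of rate at least `R - δ` whose maximal error
probability against every such jammer is less than `ε`. -/
def Network.AchievableOmniscientJamming {V E : Type*} (G : Network V E) (z : ℕ) (R : ℝ) : Prop :=
  ∀ ε > (0 : ℝ), ∀ δ > (0 : ℝ), ∃ τ n₀ q₀ : ℕ, 0 < τ ∧ 0 < n₀ ∧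
    ∀ n ≥ n₀, ∀ (F : Type) [Field F] [Fintype F], q₀ ≤ Fintype.card F →
      ∃ c : RoutingCode G F n τ, R - δ ≤ c.rate ∧
        ∀ Z : Finset V, G.IsInternalSet z Z →
          ∀ (σ : PMF (CausalJammer G F n τ)) (m : Fin c.messageLength → F),
            c.errorProb Z σ m < ENNReal.ofReal ε

/-! Scale the LP flow by a large `B` and round down: this gives `S` paths that share every edge at
most `B` times, and any admissible `Z` meets at most `D = ⌊lam * B⌋₊` of them. Time is cut into
blocks of `B` slots, and a packet advances one edge per block.

For `K` blocks each path carries symbols of a Reed–Solomon code of length `K * S` and dimension `K *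
(S - D)`. After a pause in which all data drain out of the network, a uniform key `r` and the list
of hashes `r ⬝ᵥ x j` of the data packets are repeated on all paths. As `2 * D < S` (this is where
`lam < C / 2` enters), the majority of the paths deliver key and hashes intact.

Causality fixes every corruption of the data before `r` leaves the source (`received_congr`). So a
corrupted packet passes its hash test with probability at most `1 / q`, and a union bound gives
error at most `K * S / q`. Discarding the packets that fail turns errors into erasures, and at least
`K * (S - D)` correct symbols remain, enough to decode (`hashDecode_eq`). The rate tends to `C -
lam` because rounding and the `2 * L + 2` extra blocks are negligible for large `B` and `K`. -/

/-! ### Simple paths and the case equations of the traffic. -/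

namespace Network.IsPath

variable {V E : Type*} {G : Network V E} {p : List E}

theorem ne_nil (hp : G.IsPath p) : p ≠ [] := by
  rintro rfl
  simpa using hp.starts

theorem tail_getElem_zero (hp : G.IsPath p) {e : E} (he : p[0]? = some e) :
    G.tail e = G.source := by
  have h := hp.starts
  rw [List.head?_eq_getElem?, he] at h
  simpa using h

theorem head_eq_tail (hp : G.IsPath p) {h : ℕ} {e e' : E} (he' : p[h]? = some e')
    (he : p[h + 1]? = some e) : G.head e' = G.tail e := by
  obtain ⟨h1, rfl⟩ := List.getElem?_eq_some_iff.1 he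
  obtain ⟨h2, rfl⟩ := List.getElem?_eq_some_iff.1 he'
  exact List.isChain_iff_getElem.1 hp.chain h h1

theorem head_getLast (hp : G.IsPath p) : G.head (p.getLast hp.ne_nil) = G.terminal := by
  have h := hp.ends
  rw [List.getLast?_eq_getLast_of_ne_nil hp.ne_nil] at h
  simpa using h

theorem nodup_edges (hp : G.IsPath p) : p.Nodup :=
  (List.nodup_cons.1 hp.nodup).2.of_map _

theorem head_mem_pathNodes {e : E} (he : e ∈ p) : G.head e ∈ G.pathNodes p :=
  List.mem_cons_of_mem _ (List.mem_map_of_mem he)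

theorem head_ne_source (hp : G.IsPath p) {e : E} (he : e ∈ p) : G.head e ≠ G.source :=
  fun h => (List.nodup_cons.1 hp.nodup).1 (h ▸ List.mem_map_of_mem he)

theorem head_ne_terminal (hp : G.IsPath p) {h : ℕ} {e : E} (he : p[h]? = some e)
    (hh : h + 1 < p.length) : G.head e ≠ G.terminal := by
  intro heq
  obtain ⟨h2, rfl⟩ := List.getElem?_eq_some_iff.1 he
  have hn := (List.nodup_cons.1 hp.nodup).2
  rw [← hp.head_getLast, List.getLast_eq_getElem] at heq
  have := (List.Nodup.getElem_inj_iff hn (i := h) (j := p.length - 1) (hi := by simpa)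
    (hj := by simp; omega)).1 (by simpa using heq)
  omega

end Network.IsPath

namespace RoutingCode.IsTraffic

variable {V E : Type*} {G : Network V E} {F : Type*} [Zero F] {n τ : ℕ} {c : RoutingCode G F n τ}
  {m : Fin c.messageLength → F} {k : Fin c.keyLength → F} {Z : Finset V}
  {A : CausalJammer G F n τ} {X : Traffic E F n τ} {e : E} {t : Fin τ}

theorem of_source (hX : c.IsTraffic m k Z A X) (he : G.tail e = G.source) :
    X e t = (c.inject e t).elim 0 (c.enc m k) :=
  (hX e t).trans (if_pos he)

theorem of_jammed (hX : c.IsTraffic m k Z A X) (he : G.tail e ≠ G.source) (hZ : G.tail e ∈ Z) :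
    X e t = A.act X e t :=
  (hX e t).trans ((if_neg he).trans (if_pos hZ))

theorem of_terminal (hX : c.IsTraffic m k Z A X) (he : G.tail e ≠ G.source) (hZ : G.tail e ∉ Z)
    (ht : G.tail e = G.terminal) : X e t = 0 :=
  (hX e t).trans ((if_neg he).trans ((if_neg hZ).trans (if_pos ht)))

theorem of_internal (hX : c.IsTraffic m k Z A X) (he : G.tail e ≠ G.source) (hZ : G.tail e ∉ Z)
    (ht : G.tail e ≠ G.terminal) : X e t = (c.forward e t).elim 0 fun a => X a.1 a.2 :=
  (hX e t).trans ((if_neg he).trans ((if_neg hZ).trans (if_neg ht)))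

end RoutingCode.IsTraffic

/-! ### Scheduling packets along paths, one edge per block. -/

/-- A family of paths from source to terminal, with repetitions allowed, together with an injective
assignment of the paths through each edge to `B` time slots of that edge. -/
structure PathPacking {V E : Type*} (G : Network V E) (I : Type*) (B : ℕ) where
  route : I → List E
  isPath : ∀ i, G.IsPath (route i)
  slot : E → I → ℕ
  slot_lt : ∀ e i, e ∈ route i → slot e i < B
  slot_inj : ∀ e i j, e ∈ route i → e ∈ route j → slot e i = slot e j → i = j

namespace PathPacking

variable {V E : Type*} {G : Network V E} {I : Type*} {B : ℕ} (P : PathPacking G I B)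

/-- Division with remainder by `B` recovers block and slot from the time, so transmissions never
collide on an edge. -/
theorem block_slot_inj {e : E} {i i' : I} {b b' : ℕ} (he : e ∈ P.route i) (he' : e ∈ P.route i')
    (h : B * b + P.slot e i = B * b' + P.slot e i') : i = i' ∧ b = b' := by
  have h1 := P.slot_lt e i he
  have h2 := P.slot_lt e i' he'
  have hb : b = b' := by
    have hB : 0 < B := by omega
    have := congrArg (· / B) h
    simpa [Nat.mul_add_div hB, Nat.div_eq_of_lt h1, Nat.div_eq_of_lt h2] using this
  subst hb
  exact ⟨P.slot_inj e i i' he he' (by omega), rfl⟩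

/-- The edge `e` repeats at time `t` what the preceding edge of a path carried one block
earlier. -/
def Forwards {τ : ℕ} (e : E) (t : Fin τ) (a : E × Fin τ) : Prop :=
  ∃ i h b, (P.route i)[h]? = some a.1 ∧ (P.route i)[h + 1]? = some e ∧
    (t : ℕ) = B * (b + 1) + P.slot e i ∧ (a.2 : ℕ) = B * b + P.slot a.1 i

/-- The first edge `e` of a path carries the packet number `k` at time `t`. -/
def Injects {N τ : ℕ} (content : ℕ → I → Option (Fin N)) (e : E) (t : Fin τ) (k : Fin N) : Prop :=
  ∃ i b, (P.route i)[0]? = some e ∧ (t : ℕ) = B * b + P.slot e i ∧ content b i = some k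

theorem Forwards.lt {τ : ℕ} {e : E} {t : Fin τ} {a : E × Fin τ} (h : P.Forwards e t a) :
    a.2 < t := by
  obtain ⟨i, h, b, h1, -, h3, h4⟩ := h
  have := P.slot_lt _ i (List.mem_of_getElem? h1)
  rw [Fin.lt_def, h3, h4, mul_add]
  omega

theorem Forwards.unique {τ : ℕ} {e : E} {t : Fin τ} {a a' : E × Fin τ} (h : P.Forwards e t a)
    (h' : P.Forwards e t a') : a = a' := by
  obtain ⟨i, h, b, h1, h2, h3, h4⟩ := h
  obtain ⟨i', h', b', h1', h2', h3', h4'⟩ := h'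
  obtain ⟨rfl, hb⟩ := P.block_slot_inj (List.mem_of_getElem? h2) (List.mem_of_getElem? h2')
    (h3.symm.trans h3')
  obtain rfl : b = b' := by omega
  have hl := (List.getElem?_eq_some_iff.1 h2).1
  have := (List.getElem?_inj hl (P.isPath i).nodup_edges).1 (h2.trans h2'.symm)
  obtain rfl : h = h' := by omega
  have h5 : a.1 = a'.1 := Option.some_injective _ (h1.symm.trans h1')
  refine Prod.ext h5 (Fin.ext ?_)
  rw [h4, h4', h5]

open Classical in
/-- The code that in its `b`-th block sends the packet number `content b i` along the path
`i`, one edge per block. -/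
noncomputable def code {F : Type*} {n τ messageLength keyLength numPackets : ℕ}
    (numPackets_le : numPackets ≤ τ * G.minCut) (content : ℕ → I → Option (Fin numPackets))
    (enc : (Fin messageLength → F) → (Fin keyLength → F) → Fin numPackets → Fin n → F)
    (dec : ({e : E // G.head e = G.terminal} → Fin τ → Fin n → F) → Fin messageLength → F) :
    RoutingCode G F n τ where
  messageLength := messageLength
  keyLength := keyLength
  numPackets := numPackets
  numPackets_le := numPackets_le
  enc := enc
  inject e t := if h : ∃ k, P.Injects content e t k then some h.choose else none
  forward e t := if h : ∃ a, P.Forwards e t a then some h.choose else none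
  forward_causal e t e' j h := by
    split_ifs at h with h'
    have h1 := h'.choose_spec
    rw [Option.some_injective _ h] at h1
    refine ⟨?_, (Forwards.lt P h1).le⟩
    obtain ⟨i, h, b, h2, h3, -⟩ := h1
    exact (P.isPath i).head_eq_tail h2 h3
  forward_wf := by
    refine Subrelation.wf (r := InvImage (· < ·) fun a : E × Fin τ => a.2) ?_
      (InvImage.wf _ wellFounded_lt)
    intro a b h
    split_ifs at h with h'
    exact Forwards.lt P (Option.some_injective _ h ▸ h'.choose_spec)
  dec := dec

section code

variable {F : Type*} {n τ messageLength keyLength numPackets : ℕ}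
    {numPackets_le : numPackets ≤ τ * G.minCut} {content : ℕ → I → Option (Fin numPackets)}
    {enc : (Fin messageLength → F) → (Fin keyLength → F) → Fin numPackets → Fin n → F}
    {dec : ({e : E // G.head e = G.terminal} → Fin τ → Fin n → F) → Fin messageLength → F}

theorem code_inject {i : I} {b : ℕ} {e : E} {t : Fin τ} (he : (P.route i)[0]? = some e)
    (ht : (t : ℕ) = B * b + P.slot e i) :
    (P.code numPackets_le content enc dec).inject e t = content b i := by
  classical
  change (if h : ∃ k, P.Injects content e t k then some h.choose else none) = _
  split_ifs with h
  · obtain ⟨i', b', h1, h2, h3⟩ := h.choose_spec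
    obtain ⟨rfl, rfl⟩ := P.block_slot_inj (List.mem_of_getElem? he) (List.mem_of_getElem? h1)
      (ht.symm.trans h2)
    exact h3.symm
  · symm
    cases hc : content b i with
    | none => rfl
    | some k => exact (h ⟨k, i, b, he, ht, hc⟩).elim

theorem code_inject_some {e : E} {t : Fin τ} {a : Fin numPackets}
    (h : (P.code numPackets_le content enc dec).inject e t = some a) :
    ∃ i b, (t : ℕ) = B * b + P.slot e i ∧ content b i = some a := by
  classical
  change (if h : ∃ k, P.Injects content e t k then some h.choose else none) = _ at h
  split_ifs at h with h'
  obtain ⟨i, b, -, h2, h3⟩ := h'.choose_spec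
  exact ⟨i, b, h2, h3.trans h⟩

theorem code_forward_lt {e : E} {t : Fin τ} {a : E × Fin τ}
    (h : (P.code numPackets_le content enc dec).forward e t = some a) : a.2 < t := by
  classical
  change (if h : ∃ a, P.Forwards e t a then some h.choose else none) = _ at h
  split_ifs at h with h'
  exact Forwards.lt P (Option.some_injective _ h ▸ h'.choose_spec)

theorem code_forward {e : E} {t : Fin τ} {a : E × Fin τ} (h : P.Forwards e t a) :
    (P.code numPackets_le content enc dec).forward e t = some a := by
  have h' : ∃ a, P.Forwards e t a := ⟨a, h⟩
  exact (dif_pos h').trans (congrArg some (Forwards.unique P h'.choose_spec h))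

/-- A packet sent along a path that avoids the jammed nodes is forwarded unchanged. -/
theorem traffic_eq [Zero F] {m : Fin messageLength → F} {k : Fin keyLength → F} {Z : Finset V}
    {A : CausalJammer G F n τ} {X : Traffic E F n τ}
    (hX : (P.code numPackets_le content enc dec).IsTraffic m k Z A X) {i : I}
    (hi : ∀ v ∈ G.pathNodes (P.route i), v ∉ Z) (b h : ℕ) {e : E}
    (he : (P.route i)[h]? = some e) {t : Fin τ} (ht : (t : ℕ) = B * (b + h) + P.slot e i) :
    X e t = (content b i).elim 0 (enc m k) := by
  induction h generalizing e t with
  | zero =>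
    rw [hX.of_source ((P.isPath i).tail_getElem_zero he), P.code_inject he ht]
    rfl
  | succ h ih =>
    have hl := (List.getElem?_eq_some_iff.1 he).1
    have he' : (P.route i)[h]? = some ((P.route i)[h]) := List.getElem?_eq_getElem _
    have htail := (P.isPath i).head_eq_tail he' he
    have hslot := P.slot_lt _ i (List.mem_of_getElem? he')
    have hlt : B * (b + h) + P.slot ((P.route i)[h]) i < τ := by
      refine lt_trans ?_ t.2
      rw [ht, ← add_assoc, mul_add B (b + h)]
      omega
    rw [hX.of_internal (htail ▸ (P.isPath i).head_ne_source (List.mem_of_getElem? he'))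
      (htail ▸ hi _ (Network.IsPath.head_mem_pathNodes (List.mem_of_getElem? he')))
      (htail ▸ (P.isPath i).head_ne_terminal he' hl),
      P.code_forward (a := ((P.route i)[h], ⟨_, hlt⟩)) ⟨i, h, b + h, he', he, ht, rfl⟩]
    exact ih he' rfl

/-- Before the time `T` the traffic does not depend on what the source emits from then on. -/
theorem traffic_congr [Zero F] {m : Fin messageLength → F} {k k' : Fin keyLength → F}
    {Z : Finset V} {A : CausalJammer G F n τ} {X Y : Traffic E F n τ} {T : ℕ}
    (hX : (P.code numPackets_le content enc dec).IsTraffic m k Z A X)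
    (hY : (P.code numPackets_le content enc dec).IsTraffic m k' Z A Y)
    (hT : ∀ b i a, B * b < T → content b i = some a → enc m k a = enc m k' a)
    (t : Fin τ) (ht : (t : ℕ) < T) (e : E) : X e t = Y e t := by
  induction t using WellFoundedLT.induction generalizing e with
  | _ t ih =>
    -- The jammer sees the source's packets of time `t` itself, so these are compared before its
    -- own.
    have hs : ∀ e, G.tail e = G.source → X e t = Y e t := by
      intro e he
      rw [hX.of_source he, hY.of_source he]
      cases hk : (P.code numPackets_le content enc dec).inject e t with
      | none => rfl
      | some a =>
        obtain ⟨i, b, h2, h3⟩ := P.code_inject_some hk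
        exact hT b i a (by omega) h3
    by_cases he : G.tail e = G.source
    · exact hs e he
    by_cases hZ : G.tail e ∈ Z
    · rw [hX.of_jammed he hZ, hY.of_jammed he hZ]
      exact A.causal X Y t (fun e j hj => ih j hj (lt_trans (Fin.lt_def.1 hj) ht) e) hs e
    by_cases hter : G.tail e = G.terminal
    · rw [hX.of_terminal he hZ hter, hY.of_terminal he hZ hter]
    rw [hX.of_internal he hZ hter, hY.of_internal he hZ hter]
    cases hf : (P.code numPackets_le content enc dec).forward e t with
    | none => rfl
    | some a =>
      have hj := P.code_forward_lt hf
      exact ih _ hj (lt_trans (Fin.lt_def.1 hj) ht) _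

end code

/-- What the terminal receives at the end of the path `i` in the transmission that starts in block
`b`. -/
noncomputable def received {X : Type*} [Zero X] {τ : ℕ}
    (Y : {e : E // G.head e = G.terminal} → Fin τ → X) (b : ℕ) (i : I) : X :=
  if h : B * (b + ((P.route i).length - 1)) +
      P.slot ((P.route i).getLast (P.isPath i).ne_nil) i < τ then
    Y ⟨_, (P.isPath i).head_getLast⟩ ⟨_, h⟩ else 0

/-- The last of at most `L` edges is used at most `L - 1` blocks after the start, so `L` blocks
drain the network. -/
theorem received_time_lt {L b : ℕ} {i : I} (hL : (P.route i).length ≤ L) :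
    B * (b + ((P.route i).length - 1)) + P.slot ((P.route i).getLast (P.isPath i).ne_nil) i <
      B * (b + L) := by
  have h1 := P.slot_lt _ i (List.getLast_mem (P.isPath i).ne_nil)
  have h2 := List.length_pos_iff.2 (P.isPath i).ne_nil
  calc _ < B * (b + ((P.route i).length - 1)) + B := by omega
    _ = B * (b + ((P.route i).length - 1) + 1) := by ring
    _ ≤ _ := Nat.mul_le_mul_left _ (by omega)

end PathPacking

/-! ### Erasure decoding of Reed–Solomon codes. -/

section ReedSolomon

variable {F : Type*} [Field F] {J : Type*} {k n : ℕ}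

/-- The Reed–Solomon code of dimension `k` with evaluation points `α`, applied to each of the `n`
coordinates of a packet. -/
def reedSolomon (α : J → F) (m : Fin (k * n) → F) (j : J) (b : Fin n) : F :=
  ∑ a : Fin k, m (finProdFinEquiv (a, b)) * α j ^ (a : ℕ)

theorem eq_of_reedSolomon_eq {α : J → F} (hα : α.Injective) {m m' : Fin (k * n) → F}
    (s : Finset J) (hs : k ≤ s.card) (h : ∀ j ∈ s, reedSolomon α m j = reedSolomon α m' j) :
    m = m' := by
  -- Keeping exactly `k` evaluation points makes the Vandermonde matrix square.
  obtain ⟨s, hs', rfl⟩ := Finset.exists_subset_card_eq hs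
  suffices H : ∀ a b, m (finProdFinEquiv (a, b)) = m' (finProdFinEquiv (a, b)) by
    funext x
    obtain ⟨⟨a, b⟩, rfl⟩ := finProdFinEquiv.surjective x
    exact H a b
  intro a b
  let f : Fin s.card → F := fun i => α (s.equivFin.symm i)
  have hf : f.Injective := fun x y hxy =>
    s.equivFin.symm.injective (Subtype.ext (hα hxy))
  have hdet : (Matrix.vandermonde f).det ≠ 0 := Matrix.det_vandermonde_ne_zero_iff.2 hf
  have hv := Matrix.eq_zero_of_mulVec_eq_zero hdet
    (v := fun a => m (finProdFinEquiv (a, b)) - m' (finProdFinEquiv (a, b))) (by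
      funext i
      have := congrFun (h _ (hs' (s.equivFin.symm i).2)) b
      simp only [reedSolomon] at this
      simp only [Matrix.mulVec, dotProduct, Matrix.vandermonde_apply, f, Pi.zero_apply, mul_sub,
        Finset.sum_sub_distrib, sub_eq_zero]
      simpa only [mul_comm] using this)
  exact sub_eq_zero.1 (congrFun hv a)

end ReedSolomon

/-! ### Random linear hashes. -/

section Hash

variable {F : Type*} [Field F] {n : ℕ}

/-- A random linear hash of a nonzero vector vanishes with probability at most `1 / q`. -/
theorem card_dotProduct_eq_zero_mul_card_le [Fintype F] [DecidableEq F] {d : Fin n → F}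
    (hd : d ≠ 0) :
    (Finset.univ.filter fun r : Fin n → F => r ⬝ᵥ d = 0).card * Fintype.card F ≤
      Fintype.card (Fin n → F) := by
  obtain ⟨b, hb⟩ := Function.ne_iff.1 hd
  rw [← Finset.card_univ (α := F), ← Finset.card_product, ← Finset.card_univ]
  -- Translating the kernel of `d` along a coordinate with `d b ≠ 0` gives `q` disjoint copies:
  -- pairing with `d` returns `c * d b`, hence `c`.
  refine Finset.card_le_card_of_injOn (fun x => x.1 + Pi.single b x.2) (fun _ _ => by simp) ?_
  rintro ⟨r, c⟩ hr ⟨r', c'⟩ hr' h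
  simp only [Finset.coe_product, Set.mem_prod, Finset.mem_coe, Finset.mem_filter_univ] at hr hr'
  have h1 := congrArg (· ⬝ᵥ d) h
  simp only [add_dotProduct, hr.1, hr'.1, single_dotProduct, zero_add] at h1
  obtain rfl : c = c' := mul_right_cancel₀ hb h1
  exact Prod.ext (add_right_cancel h) rfl

theorem card_exists_dotProduct_eq_zero_mul_card_le [Fintype F] [DecidableEq F] {J : Type*}
    [Fintype J] (d : J → Fin n → F) :
    (Finset.univ.filter fun r : Fin n → F => ∃ j, d j ≠ 0 ∧ r ⬝ᵥ d j = 0).card * Fintype.card F ≤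
      Fintype.card J * Fintype.card (Fin n → F) := by
  classical
  have hsub : (Finset.univ.filter fun r : Fin n → F => ∃ j, d j ≠ 0 ∧ r ⬝ᵥ d j = 0) ⊆
      Finset.univ.biUnion fun j => Finset.univ.filter fun r => d j ≠ 0 ∧ r ⬝ᵥ d j = 0 := by
    intro r hr
    simpa using hr
  refine (Nat.mul_le_mul_right _ ((Finset.card_le_card hsub).trans Finset.card_biUnion_le)).trans ?_
  rw [Finset.sum_mul, ← smul_eq_mul (Fintype.card J), ← Finset.card_univ (α := J)]
  refine Finset.sum_le_card_nsmul _ _ _ fun j _ => ?_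
  by_cases hd : d j = 0
  · simp [hd]
  · simpa [hd] using card_dotProduct_eq_zero_mul_card_le hd

/-- The packet that lists the hashes of all data packets. -/
noncomputable def hashPacket {J : Type*} (ι : J → Fin n) (r : Fin n → F) (x : J → Fin n → F) :
    Fin n → F :=
  Function.extend ι (fun j => r ⬝ᵥ x j) 0

end Hash

/-! ### Majority vote, hash test and decoding. -/

section Decoder

variable {F : Type*} [Field F] {n k : ℕ} {I J : Type*} [Fintype I]

open Classical in
/-- The message `m` explains the received data packets `y` whose hash is the one given by the
majority of the received pairs `w` of a key and a list of hashes. -/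
def Explains (α : J → F) (ι : J → Fin n) (y : J → Fin n → F) (w : I → (Fin n → F) × (Fin n → F))
    (m : Fin (k * n) → F) : Prop :=
  ∃ r g, Fintype.card I < 2 * (Finset.univ.filter fun i => w i = (r, g)).card ∧
    ∀ j, r ⬝ᵥ y j = g (ι j) → reedSolomon α m j = y j

open Classical in
/-- The decoder looks for a message that explains the received packets. -/
noncomputable def hashDecode (α : J → F) (ι : J → Fin n) (y : J → Fin n → F)
    (w : I → (Fin n → F) × (Fin n → F)) : Fin (k * n) → F :=
  if h : ∃ m, Explains α ι y w m then h.choose else 0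

open Classical in
-- Under `hr` every corrupted packet fails the hash test, so the true message is an explanation. Any
-- explanation agrees with it at the uncorrupted packets, which always pass, and `k` of these
-- determine the message.
theorem hashDecode_eq [Fintype J] {α : J → F} (hα : α.Injective) {ι : J → Fin n}
    (hι : ι.Injective) {y : J → Fin n → F} {w : I → (Fin n → F) × (Fin n → F)}
    {m : Fin (k * n) → F} {r : Fin n → F}
    (hw : Fintype.card I < 2 *
      (Finset.univ.filter fun i => w i = (r, hashPacket ι r (reedSolomon α m))).card)
    (hy : k ≤ (Finset.univ.filter fun j => y j = reedSolomon α m j).card)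
    (hr : ∀ j, reedSolomon α m j - y j ≠ 0 → r ⬝ᵥ (reedSolomon α m j - y j) ≠ 0) :
    hashDecode α ι y w = m := by
  have hg : ∀ j, hashPacket ι r (reedSolomon α m) (ι j) = r ⬝ᵥ reedSolomon α m j := fun j =>
    hι.extend_apply _ _ _
  have hm : ∃ m : Fin (k * n) → F, Explains α ι y w m := by
    refine ⟨m, r, _, hw, fun j hj => sub_eq_zero.1 ?_⟩
    by_contra h
    refine hr j h ?_
    rw [dotProduct_sub, hj, hg, sub_self]
  rw [hashDecode, dif_pos hm]
  obtain ⟨r', g', hw', hm'⟩ := hm.choose_spec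
  -- Two strict majorities share a path, so the voted key and hashes are the genuine ones.
  have hinter : ((Finset.univ.filter fun i => w i = (r, hashPacket ι r (reedSolomon α m))) ∩
      Finset.univ.filter fun i => w i = (r', g')).Nonempty :=
    Finset.inter_nonempty_of_card_lt_card_add_card (Finset.subset_univ _) (Finset.subset_univ _)
      (by rw [Finset.card_univ]; omega)
  obtain ⟨i, hi⟩ := hinter
  simp only [Finset.mem_inter, Finset.mem_filter_univ] at hi
  have hrg := hi.1.symm.trans hi.2
  simp only [Prod.mk.injEq] at hrg
  obtain ⟨rfl, rfl⟩ := hrg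
  refine eq_of_reedSolomon_eq hα _ hy fun j hj => ?_
  rw [Finset.mem_filter_univ] at hj
  rw [hm' j (by rw [hg, hj]), hj]

end Decoder

/-! ### Averaging over the jammer's randomness and counting bad keys. -/

namespace RoutingCode

variable {V E F : Type*} {G : Network V E} {n τ : ℕ}

/-- It suffices to bound the error probability against deterministic jammers. -/
theorem errorProb_le [Zero F] [Fintype F] (c : RoutingCode G F n τ) (Z : Finset V)
    (σ : PMF (CausalJammer G F n τ)) (m : Fin c.messageLength → F) {a : ℝ≥0∞}
    (h : ∀ A, (PMF.uniformOfFintype (Fin c.keyLength → F)).toOuterMeasure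
      {k | ∃ X, c.IsTraffic m k Z A X ∧ c.decode X ≠ m} ≤ a) :
    c.errorProb Z σ m ≤ a := by
  -- Key and strategy are independent, so the strategy may be drawn first.
  have hb : ((PMF.uniformOfFintype (Fin c.keyLength → F)).bind fun k => σ.map (Prod.mk k)) =
      σ.bind fun A => (PMF.uniformOfFintype (Fin c.keyLength → F)).map fun k => (k, A) :=
    PMF.bind_comm _ _ _
  rw [errorProb, hb, PMF.toOuterMeasure_bind_apply]
  calc _ ≤ ∑' A, σ A * a := ENNReal.tsum_le_tsum fun A => by
        gcongr
        rw [PMF.toOuterMeasure_map_apply]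
        exact h A
    _ = a := by rw [ENNReal.tsum_mul_right, σ.tsum_coe, one_mul]

end RoutingCode

theorem PMF.uniformOfFintype_toOuterMeasure_le {α : Type*} [Fintype α] [Nonempty α] (s : Set α)
    (t : Finset α) (hs : s ⊆ t) {a q : ℕ} (hq : 0 < q) (ht : t.card * q ≤ a * Fintype.card α) :
    (PMF.uniformOfFintype α).toOuterMeasure s ≤ (a : ℝ≥0∞) / q := by
  classical
  have hst : (PMF.uniformOfFintype α).toOuterMeasure s ≤
      (PMF.uniformOfFintype α).toOuterMeasure (t : Set α) := MeasureTheory.measure_mono hs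
  refine hst.trans ?_
  rw [PMF.toOuterMeasure_uniformOfFintype_apply, ENNReal.div_le_iff (by simp) (by simp),
    ← ENNReal.mul_div_right_comm,
    ENNReal.le_div_iff_mul_le (Or.inl (by simp [hq.ne'])) (Or.inl (by simp))]
  simpa using (by exact_mod_cast ht : (t.card : ℝ≥0∞) * q ≤ a * Fintype.card α)

/-! ### The hash-protected code and its error probability. -/

namespace PathPacking

variable {V E : Type*} {G : Network V E} {I : Type*} {B : ℕ} (P : PathPacking G I B)

/-- What is sent in a round: data packets in the first `K` rounds, then, after a pause of `L`
rounds, the key and the list of hashes. -/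
def roundContent (K L b : ℕ) (i : I) : Option ((Fin K × I) ⊕ Fin 2) :=
  if h : b < K then some (Sum.inl (⟨b, h⟩, i))
  else if b = K + L then some (Sum.inr 0)
  else if b = K + L + 1 then some (Sum.inr 1)
  else none

/-- The data packets, the key and the list of hashes. -/
noncomputable def packet {F J : Type*} [Field F] {n k : ℕ} (α : J → F) (ι : J → Fin n)
    (m : Fin (k * n) → F) (r : Fin n → F) : J ⊕ Fin 2 → Fin n → F :=
  Sum.elim (reedSolomon α m) ![r, hashPacket ι r (reedSolomon α m)]

/-- Data packets protected by a Reed–Solomon code, followed by a repetition of the key and the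
hashes on all paths. -/
noncomputable def hashCode [Fintype I] {F : Type*} [Field F] {n k K L N τ : ℕ}
    (α : Fin K × I → F) (ι : Fin K × I → Fin n) (f : (Fin K × I) ⊕ Fin 2 ≃ Fin N)
    (hN : N ≤ τ * G.minCut) : RoutingCode G F n τ :=
  P.code (keyLength := n) hN (fun b i => (roundContent K L b i).map f)
    (fun m r a => packet (k := k) α ι m r (f.symm a))
    (fun Y => hashDecode α ι (fun j => P.received Y j.1 j.2)
      (fun i => (P.received Y (K + L) i, P.received Y (K + L + 1) i)))

section hashCode

variable [Fintype I] {F : Type*} [Field F] {n k K L N τ : ℕ} {α : Fin K × I → F}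
  {ι : Fin K × I → Fin n} {f : (Fin K × I) ⊕ Fin 2 ≃ Fin N} {hN : N ≤ τ * G.minCut}
  {m : Fin (k * n) → F} {Z : Finset V} {A : CausalJammer G F n τ} {X : Traffic E F n τ}

theorem received_eq_of_forall_notMem {r : Fin n → F}
    (hX : (P.hashCode (k := k) (L := L) α ι f hN).IsTraffic m r Z A X) {i : I}
    (hi : ∀ v ∈ G.pathNodes (P.route i), v ∉ Z) (hL : (P.route i).length ≤ L) {b : ℕ}
    (hb : B * (b + L) ≤ τ) {a : (Fin K × I) ⊕ Fin 2} (ha : roundContent K L b i = some a) :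
    P.received (fun e t => X e.1 t) b i = packet α ι m r a := by
  have ht := (P.received_time_lt (b := b) hL).trans_le hb
  rw [received, dif_pos ht]
  refine (P.traffic_eq hX hi b ((P.route i).length - 1) ?_ rfl).trans ?_
  · rw [← List.getLast?_eq_getElem?, List.getLast?_eq_getLast_of_ne_nil]
  · simp [ha]

/-- This is where causality defeats omniscience: data sent in the first `K` blocks arrive before
block `K + L`, in which the key first appears, so their corruption cannot depend on the key. -/
theorem received_congr {r r' : Fin n → F} {X' : Traffic E F n τ}
    (hX : (P.hashCode (k := k) (L := L) α ι f hN).IsTraffic m r Z A X)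
    (hX' : (P.hashCode (k := k) (L := L) α ι f hN).IsTraffic m r' Z A X') {i : I}
    (hL : (P.route i).length ≤ L) {b : ℕ} (hb : b < K) :
    P.received (fun e t => X e.1 t) b i = P.received (fun e t => X' e.1 t) b i := by
  unfold received
  split_ifs with ht
  · refine P.traffic_congr (T := B * (K + L)) hX hX' ?_ _ ((P.received_time_lt hL).trans_le
      (Nat.mul_le_mul_left _ (by omega))) _
    intro b i a hb ha
    have hb := Nat.lt_of_mul_lt_mul_left hb
    obtain ⟨x, hx, rfl⟩ := Option.map_eq_some_iff.1 ha
    unfold roundContent at hx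
    split_ifs at hx
    · obtain rfl := Option.some_injective _ hx
      simp [packet]
    all_goals omega
  · rfl

open Classical in
theorem decode_hashCode_eq {r : Fin n → F} {D : ℕ} (hα : α.Injective) (hι : ι.Injective)
    (hτ : τ = B * (K + 2 * L + 2)) (hL : ∀ i, (P.route i).length ≤ L)
    (hD : (Finset.univ.filter fun i => ∃ v ∈ G.pathNodes (P.route i), v ∈ Z).card ≤ D)
    (hDI : 2 * D < Fintype.card I) (hk : k = K * (Fintype.card I - D))
    (hX : (P.hashCode (k := k) (L := L) α ι f hN).IsTraffic m r Z A X)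
    (hr : ∀ j : Fin K × I,
      reedSolomon α m j - P.received (fun e t => X e.1 t) j.1 j.2 ≠ 0 →
      r ⬝ᵥ (reedSolomon α m j - P.received (fun e t => X e.1 t) j.1 j.2) ≠ 0) :
    (P.hashCode (k := k) (L := L) α ι f hN).decode X = m := by
  have hgood : Fintype.card I - D ≤
      (Finset.univ.filter fun i => ¬ ∃ v ∈ G.pathNodes (P.route i), v ∈ Z).card := by
    have := Finset.card_filter_add_card_filter_not (s := Finset.univ)
      fun i => ∃ v ∈ G.pathNodes (P.route i), v ∈ Z
    rw [Finset.card_univ] at this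
    omega
  have hrec : ∀ i, (¬ ∃ v ∈ G.pathNodes (P.route i), v ∈ Z) → ∀ b ≤ K + L + 1, ∀ a,
      roundContent K L b i = some a →
      P.received (fun e t => X e.1 t) b i = packet α ι m r a := fun i hi b hb a ha =>
    P.received_eq_of_forall_notMem hX (fun v hv hZ => hi ⟨v, hv, hZ⟩) (hL i)
      -- The last transmission starts in block `K + L + 1` and needs at most `L` blocks.
      (hτ ▸ Nat.mul_le_mul_left _ (by omega)) ha
  refine hashDecode_eq (r := r) hα hι ?_ ?_ hr
  · refine lt_of_lt_of_le (b := 2 * (Fintype.card I - D)) (by omega)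
      (Nat.mul_le_mul_left _ (hgood.trans (Finset.card_le_card fun i hi => ?_)))
    rw [Finset.mem_filter_univ] at hi ⊢
    rw [hrec i hi (K + L) (by omega) (Sum.inr 0) (by simp [roundContent]),
      hrec i hi (K + L + 1) le_rfl (Sum.inr 1) (by simp [roundContent]; omega)]
    simp [packet]
  · calc k = K * (Fintype.card I - D) := hk
      _ ≤ ((Finset.univ : Finset (Fin K)) ×ˢ
          Finset.univ.filter fun i => ¬ ∃ v ∈ G.pathNodes (P.route i), v ∈ Z).card := by
          rw [Finset.card_product, Finset.card_univ, Fintype.card_fin]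
          exact Nat.mul_le_mul_left _ hgood
      _ ≤ _ := Finset.card_le_card fun j hj => by
          rw [Finset.mem_product, Finset.mem_filter_univ] at hj
          rw [Finset.mem_filter_univ]
          have := j.1.2
          exact hrec j.2 hj.2 j.1 (by omega) (Sum.inl j) (by simp [roundContent])

end hashCode

open Classical in
theorem exists_code [Fintype I] {F : Type*} [Field F] [Fintype F] {z D K L n : ℕ}
    (hL : ∀ i, (P.route i).length ≤ L)
    (hD : ∀ Z, G.IsInternalSet z Z →
      (Finset.univ.filter fun i => ∃ v ∈ G.pathNodes (P.route i), v ∈ Z).card ≤ D)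
    (hDI : 2 * D < Fintype.card I) (hn : K * Fintype.card I ≤ n)
    (hF : K * Fintype.card I ≤ Fintype.card F)
    (hN : K * Fintype.card I + 2 ≤ B * (K + 2 * L + 2) * G.minCut) :
    ∃ c : RoutingCode G F n (B * (K + 2 * L + 2)),
      c.messageLength = K * (Fintype.card I - D) * n ∧
      ∀ Z, G.IsInternalSet z Z → ∀ (σ : PMF (CausalJammer G F n (B * (K + 2 * L + 2))))
        (m : Fin c.messageLength → F), c.errorProb Z σ m ≤
          ((K * Fintype.card I : ℕ) : ℝ≥0∞) / (Fintype.card F : ℕ) := by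
  obtain ⟨α⟩ : Nonempty (Fin K × I ↪ F) :=
    Function.Embedding.nonempty_of_card_le (by simpa using hF)
  obtain ⟨ι⟩ : Nonempty (Fin K × I ↪ Fin n) :=
    Function.Embedding.nonempty_of_card_le (by simpa using hn)
  let f : (Fin K × I) ⊕ Fin 2 ≃ Fin (K * Fintype.card I + 2) :=
    Fintype.equivFinOfCardEq (by simp)
  refine ⟨P.hashCode (k := K * (Fintype.card I - D)) (L := L) α ι f hN, rfl,
    fun Z hZ σ m => RoutingCode.errorProb_le _ _ _ _ fun A => ?_⟩
  -- The traffic for key `0` serves as reference: its data errors `d` are those for every key, so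
  -- `d` is fixed while `r` is uniform.
  obtain ⟨X₀, hX₀, -⟩ := (P.hashCode (k := K * (Fintype.card I - D)) (L := L) α ι f
    hN).existsUnique_isTraffic m (0 : Fin n → F) Z A
  let d : Fin K × I → Fin n → F := fun j =>
    reedSolomon α m j - P.received (fun e t => X₀ e.1 t) j.1 j.2
  refine PMF.uniformOfFintype_toOuterMeasure_le _
    (Finset.univ.filter fun r : Fin n → F => ∃ j, d j ≠ 0 ∧ r ⬝ᵥ d j = 0) ?_ Fintype.card_pos ?_
  · rintro r ⟨X, hX, hdec⟩
    by_contra hr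
    have hr' : ¬ ∃ j, d j ≠ 0 ∧ r ⬝ᵥ d j = 0 := fun h => hr (by simpa using h)
    refine hdec (P.decode_hashCode_eq α.injective ι.injective rfl hL (hD Z hZ) hDI rfl hX
      fun j => ?_)
    rw [P.received_congr hX hX₀ (hL _) j.1.2]
    exact fun h h' => hr' ⟨j, h, h'⟩
  · have := card_exists_dotProduct_eq_zero_mul_card_le d
    rw [Fintype.card_prod, Fintype.card_fin] at this
    convert this

end PathPacking

/-! ### From the fractional flow to an integral path packing. -/

namespace PathPacking

variable {V E : Type*} {G : Network V E}

open Classical in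
theorem nonempty_of_card_le {I : Type*} [Fintype I] {B : ℕ} {route : I → List E}
    (hroute : ∀ i, G.IsPath (route i))
    (hB : ∀ e, (Finset.univ.filter fun i => e ∈ route i).card ≤ B) :
    ∃ P : PathPacking G I B, P.route = route := by
  have h : ∀ e, Nonempty ({i // e ∈ route i} ↪ Fin B) := fun e =>
    Function.Embedding.nonempty_of_card_le (by simpa [Fintype.card_subtype] using hB e)
  refine ⟨⟨route, hroute, fun e i => if h' : e ∈ route i then ((h e).some ⟨i, h'⟩ : ℕ) else 0,
    fun e i hi => ?_, fun e i j hi hj hij => ?_⟩, rfl⟩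
  · simp [hi]
  · simp only [hi, hj, dite_true] at hij
    simpa using (h e).some.injective (Fin.ext hij)

end PathPacking

open Classical in
theorem card_filter_sigma_fin {α : Type*} (s : Finset α) (f : α → ℕ) (Q : α → Prop) :
    (Finset.univ.filter fun i : Σ p : s, Fin (f p) => Q i.1).card = ∑ p ∈ s with Q p, f p := by
  rw [Finset.card_filter, Fintype.sum_sigma, Finset.sum_filter, ← Finset.sum_coe_sort s]
  refine Finset.sum_congr rfl fun p _ => ?_
  split_ifs <;> simp_all

theorem Nat.sum_floor_mul_le {α : Type*} (s : Finset α) (w : α → ℝ) (hw : ∀ p ∈ s, 0 ≤ w p)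
    (B : ℕ) : ((∑ p ∈ s, ⌊w p * B⌋₊ : ℕ) : ℝ) ≤ (∑ p ∈ s, w p) * B := by
  rw [Nat.cast_sum, Finset.sum_mul]
  exact Finset.sum_le_sum fun p hp => Nat.floor_le (mul_nonneg (hw p hp) B.cast_nonneg)

/-- Rounding loses at most one unit per path, a loss independent of `B`. -/
theorem Nat.sum_mul_sub_card_le_sum_floor {α : Type*} (s : Finset α) (w : α → ℝ) (B : ℕ) :
    (∑ p ∈ s, w p) * B - s.card ≤ (∑ p ∈ s, ⌊w p * B⌋₊ : ℕ) := by
  rw [Nat.cast_sum, Finset.sum_mul, sub_le_iff_le_add, Finset.cast_card, ← Finset.sum_add_distrib]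
  exact Finset.sum_le_sum fun p _ => (Nat.lt_floor_add_one _).le

namespace Network

variable {V E : Type*} {G : Network V E} [Finite E] {z : ℕ} {lam : ℝ}

theorem LPFeasible.lam_nonneg {flow : List E → ℝ} (h : G.LPFeasible z flow lam) : 0 ≤ lam := by
  simpa using h.balance ∅ ⟨by simp, by simp, by simp⟩

open Classical in
/-- Rounding down a path flow over `B` time slots. -/
theorem LPFeasible.exists_pathPacking {flow : List E → ℝ} (h : G.LPFeasible z flow lam) (B : ℕ) :
    ∃ P : PathPacking G (Σ p : G.paths, Fin ⌊flow p * B⌋₊) B, ∀ Z, G.IsInternalSet z Z →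
      (Finset.univ.filter fun i => ∃ v ∈ G.pathNodes (P.route i), v ∈ Z).card ≤ ⌊lam * B⌋₊ := by
  have hle : ∀ (Q : List E → Prop) (a : ℝ), ∑ p ∈ G.paths with Q p, flow p ≤ a →
      ((∑ p ∈ G.paths with Q p, ⌊flow p * B⌋₊ : ℕ) : ℝ) ≤ a * B := fun Q a ha =>
    (Nat.sum_floor_mul_le _ _ (fun p hp => h.nonneg p (Finset.mem_filter.1 hp).1) B).trans
      (by gcongr)
  obtain ⟨P, hP⟩ := PathPacking.nonempty_of_card_le (G := G) (B := B)
    (route := fun i : Σ p : G.paths, Fin ⌊flow p * B⌋₊ => (i.1 : List E))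
    (fun i => G.finite_isPath.mem_toFinset.1 i.1.2) fun e => by
      have := hle (fun p => e ∈ p) 1 (by convert h.capacity e)
      rw [one_mul, ← card_filter_sigma_fin] at this
      convert Nat.cast_le.1 this
  refine ⟨P, fun Z hZ => ?_⟩
  have := Nat.le_floor (hle (fun p => ∃ v ∈ G.pathNodes p, v ∈ Z) lam
    (by convert h.balance Z hZ))
  rw [← card_filter_sigma_fin] at this
  rw [hP]
  convert this

/-! ### Choice of parameters. -/

theorem achievableOmniscientJamming_of_lpFeasible {flow : List E → ℝ}
    (h : G.LPFeasible z flow lam) (hlam : lam < (G.minCut : ℝ) / 2) :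
    G.AchievableOmniscientJamming z ((G.minCut : ℝ) - lam) := by
  intro ε hε δ hδ
  have := Fintype.ofFinite E
  have hlam0 := h.lam_nonneg
  set C : ℝ := (G.minCut : ℝ)
  set L := Fintype.card E
  -- `B₁` keeps the rounding loss below the gap `B * (C - 2 * lam)`, whence `2 * D < S`; `B₂` limits
  -- its cost in rate to `δ / 2`.
  obtain ⟨B₁, hB₁⟩ := exists_nat_gt ((G.paths.card : ℝ) / (C - 2 * lam))
  obtain ⟨B₂, hB₂⟩ := exists_nat_gt ((G.paths.card : ℝ) / (δ / 2))
  -- With this `K` the `2 * L + 2` blocks without data cost at most the other `δ / 2`.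
  obtain ⟨K, hK⟩ := exists_nat_gt ((2 * L + 2) * (C - lam) / (δ / 2))
  obtain ⟨B, hBpos, hB₁, hB₂⟩ : ∃ B : ℕ, 0 < B ∧ (G.paths.card : ℝ) < B * (C - 2 * lam) ∧
      (G.paths.card : ℝ) < B * (δ / 2) := by
    refine ⟨B₁ + B₂ + 1, by omega, (div_lt_iff₀ (by linarith)).1 (hB₁.trans_le ?_),
      (div_lt_iff₀ (by linarith)).1 (hB₂.trans_le ?_)⟩ <;> exact_mod_cast (by omega)
  rw [div_lt_iff₀ (by linarith)] at hK
  obtain ⟨P, hP⟩ := h.exists_pathPacking B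
  set D := ⌊lam * B⌋₊
  set S := ∑ p ∈ G.paths, ⌊flow p * B⌋₊
  have hcard : Fintype.card (Σ p : G.paths, Fin ⌊flow p * B⌋₊) = S := by
    rw [Fintype.card_sigma]
    simp only [Fintype.card_fin]
    exact Finset.sum_coe_sort G.paths fun p => ⌊flow p * B⌋₊
  have hD : (D : ℝ) ≤ lam * B := Nat.floor_le (by positivity)
  have hS : C * B - G.paths.card ≤ (S : ℝ) := by
    simpa only [h.total] using Nat.sum_mul_sub_card_le_sum_floor G.paths flow B
  have hS' : S ≤ B * G.minCut := by
    have := Nat.sum_floor_mul_le G.paths flow h.nonneg B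
    rw [h.total, mul_comm] at this
    exact_mod_cast this
  have hDS : 2 * D < S := by
    have : 2 * (D : ℝ) < S := by nlinarith
    exact_mod_cast this
  have hBC : 0 < B * G.minCut := by omega
  obtain ⟨q₁, hq₁⟩ := exists_nat_gt ((K * S : ℕ) / ε)
  -- One packet must hold `K * S` hashes, which bounds `n`; the field needs `K * S` evaluation
  -- points and more than `K * S / ε` elements.
  refine ⟨B * (K + 2 * L + 2), K * S + 1, K * S + q₁ + 1, by positivity, by omega,
    fun n hn F _ _ hF => ?_⟩
  obtain ⟨c, hc, hc'⟩ := P.exists_code (F := F) (n := n) (K := K) (L := L)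
    (fun i => (P.isPath i).nodup_edges.length_le_card) hP (by omega) (by rw [hcard]; omega)
    (by rw [hcard]; omega) (by rw [hcard]; nlinarith [Nat.mul_le_mul_left K hS'])
  refine ⟨c, ?_, fun Z hZ σ m => (hc' Z hZ σ m).trans_lt ?_⟩
  · have hn0 : (0 : ℝ) < n := by exact_mod_cast (by omega : 0 < n)
    rw [RoutingCode.rate, hc, hcard, le_div_iff₀ (by positivity)]
    push_cast [show D ≤ S by omega]
    have hK' : (0 : ℝ) ≤ K := K.cast_nonneg
    have hBR : (0 : ℝ) < B := by exact_mod_cast hBpos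
    have hL' : (0 : ℝ) ≤ L := L.cast_nonneg
    have h1 : (B : ℝ) * (C - lam - δ / 2) ≤ S - D := by linarith
    have h2 : (C - lam - δ) * (K + 2 * L + 2) ≤ K * (C - lam - δ / 2) := by nlinarith
    calc (C - lam - δ) * (n * (B * (K + 2 * L + 2)))
        = (C - lam - δ) * (K + 2 * L + 2) * (B * n) := by ring
      _ ≤ K * (C - lam - δ / 2) * (B * n) := by gcongr
      _ = K * (B * (C - lam - δ / 2)) * n := by ring
      _ ≤ _ := by gcongr
  · rw [hcard]
    have hq : (q₁ : ℝ) < Fintype.card F := by exact_mod_cast (by omega)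
    have hF0 : (0 : ℝ) < Fintype.card F := by exact_mod_cast Fintype.card_pos
    rw [← ENNReal.ofReal_natCast, ← ENNReal.ofReal_natCast (Fintype.card F),
      ← ENNReal.ofReal_div_of_pos hF0, ENNReal.ofReal_lt_ofReal_iff hε, div_lt_iff₀ hF0]
    have := (div_lt_iff₀ hε).1 (hq₁.trans hq)
    linarith

end Network

theorem theorem5 {V E : Type*} [Finite V] [Finite E] (G : Network V E) (z : ℕ) (lam : ℝ)
    (hopt : G.IsLPOptimum z lam) (hlam : lam < (G.minCut : ℝ) / 2) :
    G.AchievableOmniscientJamming z ((G.minCut : ℝ) - lam) := by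
  obtain ⟨flow, h⟩ := hopt.1
  exact Network.achievableOmniscientJamming_of_lpFeasible h hlam
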